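/- Let $A$ be a set of letters, $\mathbb{Q}\langle A\rangle$ the free associative algebra with the words in $A$ as basis, and $L(A)\subseteq\mathbb{Q}\langle A\rangle$ the free Lie algebra, i.e. the Lie subalgebra generated by the letters under $[P,Q]=PQ-QP$. The group algebra $\mathbb{Q}[S_n]$ acts on the right on the homogeneous polynomials of degree $n$ by $(w_1\cdots w_n)\sigma=w_{\sigma(1)}\cdots w_{\sigma(n)}$. For a composition $\nu=[\nu_1,\dots,\nu_m]$ of $n$ (a list of positive integers with sum $n$) let $B_\nu\in\mathbb{Q}[S_n]$ be the sum of the minimal length left coset representatives of the parabolic subgroup of $S_n$ generated by the adjacent transpositions $s_i=(i,i+1)$, $1\le i<n$, with $i\notin\{\nu_1,\nu_1+\nu_2,\dots,\nu_1+\cdots+\nu_{m-1}\}$. Proposition. Let $\kappa=[\kappa_1,\dots,\kappa_k]$ and $\nu=[\nu_1,\dots,\nu_m]$ be compositions of $n$, let $P_j\in L(A)$ be homogeneous of degree $\kappa_j$ for $j=1,\dots,k$, and let $P^{(\kappa)}=P_1P_2\cdots P_k$ (an $S_n$-Lie monomial of type $\kappa$). Then $$P^{(\kappa)}B_\nu=\sum_{\boldsymbol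 z}P^{(r(\boldsymbol z))},$$ where the sum is over all $m\times k$ matrices $\boldsymbol z=(z_{ij})$ with non-negative integer entries such that 1. $\sum_i z_{ij}=\kappa_j$ for all $j$, 2. $\sum_j z_{ij}=\nu_i$ for all $i$, 3. there is exactly one non-zero entry in each column. Here $r(\boldsymbol z)$ is the composition of $n$ obtained by reading the non-zero entries of $\boldsymbol z$ by row, and $P^{(r(\boldsymbol z))}$ is the product of the $P_j$ with one factor $P_j$ for each non-zero entry $z_{ij}$, in the order in which these entries are read; it is an $S_n$-Lie monomial of type $r(\boldsymbol z)$. Moreover $P^{(\kappa)}B_\nu=0$ unless the components of $\kappa$ can be re-ordered in such a way that sums of adjacent components give the components of $\nu$ (that is, the re-ordered list can be cut into consecutive segments with sums $\nu_1,\dots,\nu_m$). -/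

import Mathlib

noncomputable section

namespace DescentAlgebra

/-! ### Coxeter length and minimal coset representatives -/

/-- The length of `g` with respect to a set `S` of generators: the least number of factors in an
expression of `g` as a product of elements of `S`. -/
def wordLength {G : Type*} [Group G] (S : Set G) (g : G) : ℕ :=
  sInf {k | ∃ l : List G, (∀ s ∈ l, s ∈ S) ∧ l.prod = g ∧ l.length = k}

/-- `X_J`: the elements `x` of minimal length in their left coset `x W_J`, where `W_J` is the
subgroup generated by `J`. -/
def minLeftCosetReps {G : Type*} [Group G] (S J : Set G) : Set G :=
  {x | ∀ w ∈ Subgroup.closure J, wordLength S x ≤ wordLength S (x * w)}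

/-! ### The symmetric group, its Coxeter generators and the elements `B_ν` -/

/-- The Coxeter generator of the symmetric group on `Fin n` that exchanges the neighbours
`i` and `i + 1` (in the usual numbering of the points by `1, …, n`, this is `s_{i+1}`). -/
def simpleRefl (n : ℕ) (i : Fin (n - 1)) : Equiv.Perm (Fin n) :=
  Equiv.swap ⟨i, by omega⟩ ⟨i + 1, by omega⟩

/-- The set `S = {s_1, …, s_{n-1}}`. -/
def simpleSet (n : ℕ) : Set (Equiv.Perm (Fin n)) := Set.range (simpleRefl n)

/-- The subset `{s_{ν_1}, s_{ν_1+ν_2}, …, s_{ν_1+⋯+ν_{k-1}}}` of `S` corresponding to the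
composition `ν = [ν_1, …, ν_k]` of `n`. -/
def simpleSubset {n : ℕ} (ν : Composition n) : Set (Equiv.Perm (Fin n)) :=
  {s | ∃ i : Fin (n - 1), s = simpleRefl n i ∧ ∃ k, ν.sizeUpTo k = (i : ℕ) + 1}

open Classical in
/-- `B_ν`, an element of the group algebra of the symmetric group: the formal sum of the minimal
length left coset representatives of `W_K`, where `K` is the complement in `S` of the subset
corresponding to `ν`. -/
def descentBasis {n : ℕ} (ν : Composition n) : MonoidAlgebra ℚ (Equiv.Perm (Fin n)) :=
  ∑ σ : Equiv.Perm (Fin n) with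
      σ ∈ minLeftCosetReps (simpleSet n) (simpleSet n \ simpleSubset ν),
    MonoidAlgebra.single σ 1

/-! ### Noncommutative polynomials, Lie polynomials and the place action -/

/-- The free associative algebra `ℚ⟨A⟩`, with the words in the letters `A` as a basis. -/
abbrev NCPoly (A : Type*) := MonoidAlgebra ℚ (FreeMonoid A)

attribute [local instance] LieRing.ofAssociativeRing

/-- The free Lie algebra `L(A)`, as the Lie subalgebra of `ℚ⟨A⟩` (with bracket
`[P, Q] = P Q - Q P`) generated by the letters. -/
def freeLie (A : Type*) : LieSubalgebra ℚ (NCPoly A) :=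
  LieSubalgebra.lieSpan ℚ (NCPoly A)
    (Set.range fun a : A => (MonoidAlgebra.single (FreeMonoid.of a) (1 : ℚ) : NCPoly A))

/-- `x` is homogeneous of degree `d`: only words of length `d` occur in `x`. -/
def IsHomog {A : Type*} (d : ℕ) (x : NCPoly A) : Prop :=
  ∀ w : FreeMonoid A, x.coeff w ≠ 0 → w.length = d

/-- The right action of a permutation of the `n` places on a word:
`(w_1 ⋯ w_n) · σ = w_{σ(1)} ⋯ w_{σ(n)}`. Words of length different from `n` are sent to `0`. -/
def wordAct {A : Type*} (n : ℕ) (w : FreeMonoid A) (σ : Equiv.Perm (Fin n)) : NCPoly A :=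
  if h : w.toList.length = n then
    MonoidAlgebra.single
      (FreeMonoid.ofList (List.ofFn fun i : Fin n => w.toList.get ((σ i).cast h.symm))) 1
  else 0

/-- The right action `x · f` of the group algebra `ℚ[S_n]` on noncommutative polynomials,
the bilinear extension of `wordAct`. -/
def polyAct {A : Type*} {n : ℕ} (x : NCPoly A) (f : MonoidAlgebra ℚ (Equiv.Perm (Fin n))) :
    NCPoly A :=
  x.coeff.sum fun w a => f.coeff.sum fun σ b => (a * b) • wordAct n w σ

/-- `P_1, …, P_k` are homogeneous Lie polynomials whose degrees are the components of `κ`. -/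
def IsLieFamily {A : Type*} {n : ℕ} (κ : Composition n) (P : Fin κ.length → NCPoly A) : Prop :=
  ∀ j, P j ∈ freeLie A ∧ IsHomog (κ.blocksFun j) (P j)

/-- `x` is an `S_n`-Lie monomial of type `κ`: a concatenation product `P_1 ⋯ P_k` of homogeneous
Lie polynomials whose degrees are the components of `κ`. -/
def IsLieMonomial {A : Type*} {n : ℕ} (κ : Composition n) (x : NCPoly A) : Prop :=
  ∃ P : Fin κ.length → NCPoly A, IsLieFamily κ P ∧ x = (List.ofFn P).prod

/-! ### The matrices -/

/-- The positions of the nonzero entries of a matrix, read by row: from left to right within a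
row, and the rows from top to bottom. -/
def nonzeroCells {k l : ℕ} (z : Matrix (Fin k) (Fin l) ℕ) : List (Fin k × Fin l) :=
  (List.finRange k).flatMap fun i =>
    ((List.finRange l).filter fun j => z i j ≠ 0).map fun j => (i, j)

/-- `r(z)`: the nonzero entries of `z`, read by row. -/
def rowReading {k l : ℕ} (z : Matrix (Fin k) (Fin l) ℕ) : List ℕ :=
  (nonzeroCells z).map fun c => z c.1 c.2

/-- `P^{(r(z))}`: the concatenation product of the `P_j`, one factor `P_j` for each nonzero entry
`z_{ij}`, in the order in which these entries are read by row. -/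
def rowProduct {A : Type*} {k l : ℕ} (P : Fin l → NCPoly A) (z : Matrix (Fin k) (Fin l) ℕ) :
    NCPoly A :=
  ((nonzeroCells z).map fun c => P c.2).prod

/-- The matrices with nonnegative integer entries, column sums `κ`, row sums `ν`, and exactly one
nonzero entry in each column. -/
def actionMatrices {n : ℕ} (κ ν : Composition n) :
    Set (Matrix (Fin ν.length) (Fin κ.length) ℕ) :=
  {z | (∀ j, ∑ i, z i j = κ.blocksFun j) ∧ (∀ i, ∑ j, z i j = ν.blocksFun i) ∧
    ∀ j, ∃! i, z i j ≠ 0}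

theorem actionMatrices_finite {n : ℕ} (κ ν : Composition n) : (actionMatrices κ ν).Finite := by
  have h : (Set.Iic (fun (_ : Fin ν.length) (j : Fin κ.length) => κ.blocksFun j)).Finite :=
    Set.finite_Iic _
  refine h.subset fun z hz i j => ?_
  change z i j ≤ κ.blocksFun j
  rw [← hz.1 j]
  exact Finset.single_le_sum (f := fun i => z i j) (fun _ _ => Nat.zero_le _) (Finset.mem_univ i)

/-- Sums of adjacent members of the list `l` give the members of `m`, in order: `l` can be cut
into consecutive segments whose sums are the members of `m`. -/
def AdjacentSums (l m : List ℕ) : Prop :=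
  ∃ L : List (List ℕ), L.flatten = l ∧ L.map List.sum = m

end DescentAlgebra

end

/-! Let `coprod` be the m-fold unshuffle coproduct, with m the number of parts of ν: the algebra map
for which every letter is primitive. The key fact is `polyAct_descentBasis`: acting by B_ν means
taking the component of multidegree ν of the coproduct and multiplying its tensor factors together.

For a product of primitive homogeneous factors, expanding the coproduct assigns each factor j to a
tensor slot f j. Multiplying out then lists the factors slot by slot, in their original order within
a slot, and the multidegree condition says that the degrees in slot i add up to ν_i
(`concat_degProj_coprod`). This expansion is used twice. For words the factors are letters, and the
stable sorts of the admissible f are exactly the permutations increasing on the blocks of ν, which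
are the minimal coset representatives (`mem_minLeftCosetReps_iff`, `sum_wordAct_eq`); this proves
the key fact. For P_1 ⋯ P_k the factors are Lie polynomials, which are primitive
(`coprod_of_mem_freeLie`), and the admissible f are the matrices z, f j being the row of the nonzero
entry in column j. -/

namespace DescentAlgebra

/-! ### Length and inversions in the symmetric group -/

/-- The set of inversions of a permutation. -/
def inversions {n : ℕ} (σ : Equiv.Perm (Fin n)) : Finset (Fin n × Fin n) :=
  {p | p.1 < p.2 ∧ σ p.2 < σ p.1}

theorem mem_inversions {n : ℕ} {σ : Equiv.Perm (Fin n)} {p : Fin n × Fin n} :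
    p ∈ inversions σ ↔ p.1 < p.2 ∧ σ p.2 < σ p.1 := by
  simp [inversions]

theorem simpleRefl_mul_self {n : ℕ} (i : Fin (n - 1)) : simpleRefl n i * simpleRefl n i = 1 :=
  Equiv.swap_mul_self _ _

theorem simpleRefl_apply_left {n : ℕ} (i : Fin (n - 1)) :
    simpleRefl n i ⟨i, by omega⟩ = ⟨i + 1, by omega⟩ :=
  Equiv.swap_apply_left _ _

theorem simpleRefl_apply_right {n : ℕ} (i : Fin (n - 1)) :
    simpleRefl n i ⟨i + 1, by omega⟩ = ⟨i, by omega⟩ :=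
  Equiv.swap_apply_right _ _

theorem simpleRefl_apply_val {n : ℕ} (i : Fin (n - 1)) (p : Fin n) :
    (simpleRefl n i p : ℕ) =
      if (p : ℕ) = i then (i : ℕ) + 1 else if (p : ℕ) = i + 1 then (i : ℕ) else p := by
  simp only [simpleRefl, Equiv.swap_apply_def, Fin.ext_iff]
  split_ifs <;> rfl

theorem simpleRefl_lt {n : ℕ} (i : Fin (n - 1)) {p q : Fin n} (h : p < q)
    (hne : ¬ ((p : ℕ) = i ∧ (q : ℕ) = i + 1)) : simpleRefl n i p < simpleRefl n i q := by
  rw [Fin.lt_def, simpleRefl_apply_val, simpleRefl_apply_val]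
  rw [Fin.lt_def] at h
  split_ifs <;> omega

/-- The reflection preserves the order of every pair except (i, i + 1). It therefore carries the
inversions of σ to those of the product, and the exceptional pair is the only new one. -/
theorem card_inversions_mul_simpleRefl_of_lt {n : ℕ} {σ : Equiv.Perm (Fin n)} {i : Fin (n - 1)}
    (h : σ ⟨i, by omega⟩ < σ ⟨i + 1, by omega⟩) :
    (inversions (σ * simpleRefl n i)).card = (inversions σ).card + 1 := by
  classical
  set s := simpleRefl n i with hs
  have hss : ∀ p, s (s p) = p := fun p => by
    rw [← Equiv.Perm.mul_apply, hs, simpleRefl_mul_self, Equiv.Perm.one_apply]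
  have key : inversions (σ * s) =
      insert (⟨i, by omega⟩, ⟨i + 1, by omega⟩)
        ((inversions σ).image fun p => (s p.1, s p.2)) := by
    ext ⟨p, q⟩
    simp only [mem_inversions, Finset.mem_insert, Finset.mem_image, Prod.mk.injEq,
      Equiv.Perm.mul_apply, Prod.exists]
    constructor
    · rintro ⟨hpq, hσ⟩
      by_cases hne : (p : ℕ) = i ∧ (q : ℕ) = i + 1
      · exact Or.inl ⟨Fin.ext hne.1, Fin.ext hne.2⟩
      · exact Or.inr ⟨s p, s q, ⟨simpleRefl_lt i hpq hne, hσ⟩, hss p, hss q⟩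
    · rintro (⟨rfl, rfl⟩ | ⟨a, b, ⟨hab, hσ⟩, rfl, rfl⟩)
      · refine ⟨by simp, ?_⟩
        rw [hs, simpleRefl_apply_left, simpleRefl_apply_right]
        exact h
      · rw [hss, hss]
        refine ⟨simpleRefl_lt i hab ?_, hσ⟩
        rintro ⟨ha, hb⟩
        have ha' : a = ⟨i, by omega⟩ := Fin.ext ha
        have hb' : b = ⟨i + 1, by omega⟩ := Fin.ext hb
        rw [← ha', ← hb'] at h
        exact lt_asymm h hσ
  rw [key, Finset.card_insert_of_notMem, Finset.card_image_of_injective]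
  · rintro ⟨a, b⟩ ⟨c, d⟩ h
    simpa using h
  · simp only [Finset.mem_image, mem_inversions, Prod.mk.injEq, Prod.exists, not_exists, not_and]
    rintro a b ⟨hab, -⟩ ha hb
    have h1 := congrArg s ha
    have h2 := congrArg s hb
    rw [hss, hs, simpleRefl_apply_left] at h1
    rw [hss, hs, simpleRefl_apply_right] at h2
    rw [h1, h2, Fin.lt_def] at hab
    simp only at hab
    omega

theorem card_inversions_mul_simpleRefl_of_gt {n : ℕ} {σ : Equiv.Perm (Fin n)} {i : Fin (n - 1)}
    (h : σ ⟨i + 1, by omega⟩ < σ ⟨i, by omega⟩) :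
    (inversions (σ * simpleRefl n i)).card + 1 = (inversions σ).card := by
  rw [← card_inversions_mul_simpleRefl_of_lt (σ := σ * simpleRefl n i) (i := i), mul_assoc,
    simpleRefl_mul_self, mul_one]
  simpa [Equiv.Perm.mul_apply, simpleRefl_apply_left, simpleRefl_apply_right] using h

theorem card_inversions_one (n : ℕ) : (inversions (1 : Equiv.Perm (Fin n))).card = 0 := by
  rw [Finset.card_eq_zero, Finset.eq_empty_iff_forall_notMem]
  rintro ⟨a, b⟩ h
  rw [mem_inversions] at h
  exact lt_asymm h.1 h.2

/-- A function that increases along adjacent points with the same label increases along all points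
with the same label, provided that the labelling is monotone. -/
theorem lt_of_adjacent_lt {n : ℕ} {α β : Type*} [Preorder α] [PartialOrder β] {f : Fin n → α}
    {b : Fin n → β} (hb : Monotone b)
    (h : ∀ i : Fin (n - 1), b ⟨i, by omega⟩ = b ⟨i + 1, by omega⟩ →
      f ⟨i, by omega⟩ < f ⟨i + 1, by omega⟩)
    {i j : Fin n} (hij : i < j) (hbij : b i = b j) : f i < f j := by
  obtain ⟨i, hi⟩ := i
  obtain ⟨j, hj⟩ := j
  rw [Fin.mk_lt_mk] at hij
  induction j, (hij : i + 1 ≤ j) using Nat.le_induction with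
  | base => exact h ⟨i, by omega⟩ hbij
  | succ k hk ih =>
    have h1 : b ⟨i, hi⟩ ≤ b ⟨k, by omega⟩ := hb (by rw [Fin.mk_le_mk]; omega)
    have h2 : b ⟨k, by omega⟩ ≤ b ⟨k + 1, hj⟩ := hb (by rw [Fin.mk_le_mk]; omega)
    exact (ih (by omega) (le_antisymm h1 (h2.trans hbij.ge))).trans
      (h ⟨k, by omega⟩ (le_antisymm h2 (hbij.ge.trans h1)))

/-- Bubble sort: each swap at a descent removes exactly one inversion. -/
theorem exists_word_length_eq_card_inversions {n : ℕ} (σ : Equiv.Perm (Fin n)) :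
    ∃ l : List (Equiv.Perm (Fin n)), (∀ s ∈ l, s ∈ simpleSet n) ∧ l.prod = σ ∧
      l.length = (inversions σ).card := by
  induction hk : (inversions σ).card generalizing σ with
  | zero =>
    refine ⟨[], by simp, ?_, rfl⟩
    -- The constant labelling makes all points one block, so the absence of adjacent descents makes
    -- σ increasing everywhere, hence the identity.
    have hmono : StrictMono σ := fun i j hij =>
      lt_of_adjacent_lt (b := fun _ => (0 : ℕ)) monotone_const (fun i _ => by
        by_contra hcon
        have hne : σ ⟨i + 1, by omega⟩ ≠ σ ⟨i, by omega⟩ := fun he => by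
          simpa using σ.injective he
        have := card_inversions_mul_simpleRefl_of_gt (lt_of_le_of_ne (not_lt.mp hcon) hne)
        omega) hij rfl
    exact (σ.monotone_iff.mp hmono.monotone).symm
  | succ k ih =>
    by_cases hdesc : ∃ i : Fin (n - 1), σ ⟨i + 1, by omega⟩ < σ ⟨i, by omega⟩
    · obtain ⟨i, hi⟩ := hdesc
      have hcard := card_inversions_mul_simpleRefl_of_gt hi
      obtain ⟨l, hl, hprod, hlen⟩ := ih (σ * simpleRefl n i) (by omega)
      refine ⟨l ++ [simpleRefl n i], ?_, ?_, by simp [hlen]⟩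
      · intro s hs
        rcases List.mem_append.mp hs with hs | hs
        · exact hl s hs
        · rw [List.mem_singleton.mp hs]
          exact ⟨i, rfl⟩
      · rw [List.prod_append, hprod, List.prod_singleton, mul_assoc, simpleRefl_mul_self, mul_one]
    · exfalso
      have hmono : StrictMono σ := fun i j hij =>
        lt_of_adjacent_lt (b := fun _ => (0 : ℕ)) monotone_const (fun i _ =>
          lt_of_le_of_ne (not_lt.mp fun h => hdesc ⟨i, h⟩) fun he => by
            simpa using σ.injective he) hij rfl
      rw [σ.monotone_iff.mp hmono.monotone] at hk
      rw [card_inversions_one] at hk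
      omega

theorem card_inversions_prod_le {n : ℕ} (l : List (Equiv.Perm (Fin n)))
    (hl : ∀ s ∈ l, s ∈ simpleSet n) : (inversions l.prod).card ≤ l.length := by
  induction l using List.reverseRecOn with
  | nil => simp [card_inversions_one]
  | append_singleton l s ih =>
    obtain ⟨i, rfl⟩ := hl s (by simp)
    have := ih fun s hs => hl s (by simp [hs])
    rw [List.prod_append, List.prod_singleton, List.length_append, List.length_singleton]
    rcases lt_trichotomy (l.prod ⟨i, by omega⟩) (l.prod ⟨i + 1, by omega⟩) with h | h | h
    · rw [card_inversions_mul_simpleRefl_of_lt h]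
      omega
    · simpa using l.prod.injective h
    · have := card_inversions_mul_simpleRefl_of_gt h
      omega

/-- The Coxeter length of a permutation is its number of inversions. -/
theorem wordLength_simpleSet {n : ℕ} (σ : Equiv.Perm (Fin n)) :
    wordLength (simpleSet n) σ = (inversions σ).card := by
  have hmem := exists_word_length_eq_card_inversions σ
  refine le_antisymm (Nat.sInf_le hmem) (le_csInf ⟨_, hmem⟩ ?_)
  rintro k ⟨l, hl, rfl, rfl⟩
  exact card_inversions_prod_le l hl

/-! ### Minimal coset representatives of Young subgroups -/

theorem index_monotone {n : ℕ} (ν : Composition n) : Monotone ν.index := by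
  intro i j hij
  by_contra h
  have h1 : ν.sizeUpTo ((ν.index j : ℕ) + 1) ≤ ν.sizeUpTo (ν.index i) :=
    ν.monotone_sizeUpTo (by have := Fin.lt_def.mp (not_le.mp h); omega)
  have h2 := ν.lt_sizeUpTo_index_succ j
  have h3 := ν.sizeUpTo_index_le i
  rw [Fin.le_def] at hij
  simp only [Fin.val_succ] at h2
  omega

/-- Adjacent points lie in the same block exactly if no block ends between them. -/
theorem index_eq_index_succ_iff {n : ℕ} (ν : Composition n) (i : Fin (n - 1)) :
    ν.index ⟨i, by omega⟩ = ν.index ⟨i + 1, by omega⟩ ↔ ¬ ∃ k, ν.sizeUpTo k = (i : ℕ) + 1 := by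
  have h1 := ν.sizeUpTo_index_le ⟨i, by omega⟩
  have h2 := ν.lt_sizeUpTo_index_succ ⟨i, by omega⟩
  have h3 := ν.sizeUpTo_index_le ⟨i + 1, by omega⟩
  have h4 := ν.lt_sizeUpTo_index_succ ⟨i + 1, by omega⟩
  simp only [Fin.val_succ] at h1 h2 h3 h4
  constructor
  · rintro h ⟨k, hk⟩
    rw [← h] at h3 h4
    rcases le_or_gt k (ν.index ⟨i, by omega⟩) with hle | hlt
    · have := ν.monotone_sizeUpTo hle
      omega
    · have := ν.monotone_sizeUpTo (Nat.succ_le_of_lt hlt)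
      simp only [Nat.succ_eq_add_one] at this
      omega
  · intro h
    by_contra hne
    have hlt : ν.index ⟨i, by omega⟩ < ν.index ⟨i + 1, by omega⟩ :=
      lt_of_le_of_ne (index_monotone ν (by rw [Fin.mk_le_mk]; omega)) hne
    have h5 := ν.monotone_sizeUpTo (Nat.succ_le_of_lt (Fin.lt_def.mp hlt))
    simp only [Nat.succ_eq_add_one] at h5
    exact h ⟨(ν.index ⟨i, by omega⟩ : ℕ) + 1, by omega⟩

theorem simpleRefl_injective (n : ℕ) : Function.Injective (simpleRefl n) := by
  intro i j h
  have h1 := congrArg Fin.val (Equiv.congr_fun h ⟨i, by omega⟩)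
  rw [simpleRefl_apply_val, simpleRefl_apply_val] at h1
  simp only [if_true] at h1
  apply Fin.ext
  split_ifs at h1 <;> omega

theorem simpleRefl_mem_diff_iff {n : ℕ} (ν : Composition n) (i : Fin (n - 1)) :
    simpleRefl n i ∈ simpleSet n \ simpleSubset ν ↔
      ν.index ⟨i, by omega⟩ = ν.index ⟨i + 1, by omega⟩ := by
  rw [index_eq_index_succ_iff]
  constructor
  · rintro ⟨-, h⟩ hk
    exact h ⟨i, rfl, hk⟩
  · refine fun h => ⟨⟨i, rfl⟩, ?_⟩
    rintro ⟨j, hj, hk⟩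
    rw [← simpleRefl_injective n hj] at hk
    exact h hk

theorem index_apply_of_mem_closure {n : ℕ} (ν : Composition n) {w : Equiv.Perm (Fin n)}
    (hw : w ∈ Subgroup.closure (simpleSet n \ simpleSubset ν)) (p : Fin n) :
    ν.index (w p) = ν.index p := by
  induction hw using Subgroup.closure_induction generalizing p with
  | mem s hs =>
    obtain ⟨i, rfl⟩ := hs.1
    have h := (simpleRefl_mem_diff_iff ν i).mp hs
    rw [simpleRefl, Equiv.swap_apply_def]
    split_ifs with h1 h2
    · rw [h1, h]
    · rw [h2, h]
    · rfl
  | one => rfl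
  | mul x y _ _ hx hy => rw [Equiv.Perm.mul_apply, hx, hy]
  | inv x _ hx => simpa using (hx (x⁻¹ p)).symm

/-- The minimal length representatives of the left cosets of a Young subgroup are the permutations
that increase along each block. -/
theorem mem_minLeftCosetReps_iff {n : ℕ} (ν : Composition n) (σ : Equiv.Perm (Fin n)) :
    σ ∈ minLeftCosetReps (simpleSet n) (simpleSet n \ simpleSubset ν) ↔
      ∀ i j, i < j → ν.index i = ν.index j → σ i < σ j := by
  simp only [minLeftCosetReps, Set.mem_ofPred_eq, wordLength_simpleSet]
  constructor
  · intro h i j hij hindex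
    refine lt_of_adjacent_lt (index_monotone ν) (fun i hi => ?_) hij hindex
    by_contra hcon
    have hne : σ ⟨i + 1, by omega⟩ ≠ σ ⟨i, by omega⟩ := fun he => by
      simpa using σ.injective he
    have h1 := card_inversions_mul_simpleRefl_of_gt (lt_of_le_of_ne (not_lt.mp hcon) hne)
    -- A descent inside a block could be undone by a generator of the Young subgroup, giving a
    -- shorter element of the coset.
    have h2 := h _ (Subgroup.subset_closure ((simpleRefl_mem_diff_iff ν i).mpr hi))
    omega
  · intro h w hw
    have hw' := (Subgroup.closure (simpleSet n \ simpleSubset ν)).inv_mem hw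
    -- Since σ increases on blocks, its inversions join different blocks. As w⁻¹ preserves each
    -- block, it keeps such pairs in order and sends them to inversions of σ * w.
    refine Finset.card_le_card_of_injOn (fun p => (w⁻¹ p.1, w⁻¹ p.2)) ?_ ?_
    · rintro ⟨a, b⟩ hab
      obtain ⟨hab, hσ⟩ := mem_inversions.mp hab
      refine mem_inversions.mpr ⟨?_, by simpa using hσ⟩
      have hlt : ν.index a < ν.index b :=
        lt_of_le_of_ne (index_monotone ν hab.le) fun he => lt_asymm hσ (h a b hab he)
      rw [← index_apply_of_mem_closure ν hw' a, ← index_apply_of_mem_closure ν hw' b] at hlt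
      exact (index_monotone ν).reflect_lt hlt
    · rintro ⟨a, b⟩ - ⟨c, d⟩ - h
      simpa using h

end DescentAlgebra

universe u

noncomputable section

namespace DescentAlgebra

attribute [local instance] LieRing.ofAssociativeRing

/-! ### Tensor powers of the free associative algebra and the unshuffle coproduct -/

/-- The `m`-th tensor power of `ℚ⟨A⟩`, with the `m`-tuples of words as a basis. -/
abbrev TensorPow (A : Type*) (m : ℕ) := MonoidAlgebra ℚ (Fin m → FreeMonoid A)

/-- The embedding `x ↦ 1 ⊗ ⋯ ⊗ x ⊗ ⋯ ⊗ 1` into the `i`-th tensor factor. -/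
def slot {A : Type*} {m : ℕ} (i : Fin m) : NCPoly A →ₐ[ℚ] TensorPow A m :=
  MonoidAlgebra.mapDomainAlgHom ℚ ℚ (MonoidHom.mulSingle (fun _ => FreeMonoid A) i)

/-- The iterated unshuffle coproduct, for which the letters are primitive. -/
def coprod (A : Type*) (m : ℕ) : NCPoly A →ₐ[ℚ] TensorPow A m :=
  MonoidAlgebra.lift ℚ _ _
    (FreeMonoid.lift fun a => ∑ i, slot i (MonoidAlgebra.single (FreeMonoid.of a) 1))

/-- The iterated product `x_1 ⊗ ⋯ ⊗ x_m ↦ x_1 ⋯ x_m`. -/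
def concat (A : Type*) (m : ℕ) : TensorPow A m →ₗ[ℚ] NCPoly A :=
  MonoidAlgebra.mapDomainLinearMap ℚ ℚ fun u => (List.ofFn u).prod

/-- The projection onto the part of multidegree `d`. -/
def degProj (A : Type*) {m : ℕ} (d : Fin m → ℕ) : TensorPow A m →ₗ[ℚ] TensorPow A m :=
  (MonoidAlgebra.basis (Fin m → FreeMonoid A) ℚ).constr ℚ fun u =>
    if (fun i => (u i).length) = d then MonoidAlgebra.single u 1 else 0

theorem slot_single {A : Type*} {m : ℕ} (i : Fin m) (w : FreeMonoid A) (r : ℚ) :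
    slot i (MonoidAlgebra.single w r) = MonoidAlgebra.single (Pi.mulSingle i w) r := by
  simp [slot]

theorem concat_single {A : Type*} {m : ℕ} (u : Fin m → FreeMonoid A) (r : ℚ) :
    concat A m (MonoidAlgebra.single u r) = MonoidAlgebra.single (List.ofFn u).prod r := by
  simp [concat]

theorem degProj_single {A : Type*} {m : ℕ} (d : Fin m → ℕ) (u : Fin m → FreeMonoid A) (r : ℚ) :
    degProj A d (MonoidAlgebra.single u r) =
      if (fun i => (u i).length) = d then MonoidAlgebra.single u r else 0 := by
  have h : MonoidAlgebra.single u r = r • MonoidAlgebra.basis (Fin m → FreeMonoid A) ℚ u := by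
    simp [MonoidAlgebra.basis_apply]
  rw [h, map_smul, degProj, Module.Basis.constr_basis, MonoidAlgebra.basis_apply]
  split_ifs <;> simp

theorem coprod_letter {A : Type*} {m : ℕ} (a : A) :
    coprod A m (MonoidAlgebra.single (FreeMonoid.of a) 1) =
      ∑ i, slot i (MonoidAlgebra.single (FreeMonoid.of a) 1) := by
  simp [coprod]

theorem commute_slot {A : Type*} {m : ℕ} {i j : Fin m} (hij : i ≠ j) (x y : NCPoly A) :
    Commute (slot i x) (slot j y) := by
  induction x using MonoidAlgebra.induction_linear with
  | zero => simp
  | add x₁ x₂ h₁ h₂ => rw [map_add]; exact h₁.add_left h₂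
  | single u r =>
    induction y using MonoidAlgebra.induction_linear with
    | zero => simp
    | add y₁ y₂ h₁ h₂ => rw [map_add]; exact h₁.add_right h₂
    | single v s =>
      rw [slot_single, slot_single, commute_iff_eq, MonoidAlgebra.single_mul_single,
        MonoidAlgebra.single_mul_single, mul_comm r s,
        (Pi.mulSingle_commute (f := fun _ => FreeMonoid A) hij u v).eq]

/-- Lie polynomials are primitive. -/
theorem coprod_of_mem_freeLie {A : Type*} (m : ℕ) {x : NCPoly A} (hx : x ∈ freeLie A) :
    coprod A m x = ∑ i, slot i x := by
  induction hx using LieSubalgebra.lieSpan_induction with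
  | mem x hx =>
    obtain ⟨a, rfl⟩ := hx
    exact coprod_letter a
  | zero => simp
  | add x y _ _ hx hy => simp only [map_add, hx, hy, Finset.sum_add_distrib]
  | smul r x _ hx => simp only [map_smul, hx, Finset.smul_sum]
  | lie x y _ _ hx hy =>
    simp only [LieRing.of_associative_ring_bracket, map_sub, map_mul, hx, hy,
      Finset.sum_sub_distrib, Finset.sum_mul_sum]
    rw [Finset.sum_comm (f := fun i j => slot i y * slot j x), ← Finset.sum_sub_distrib,
      ← Finset.sum_sub_distrib]
    refine Finset.sum_congr rfl fun i _ => ?_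
    -- Different tensor slots commute, so only the diagonal terms of the commutator survive.
    rw [← Finset.sum_sub_distrib, Finset.sum_eq_single i]
    · intro j _ hji
      rw [(commute_slot hji.symm x y).eq, sub_self]
    · simp

theorem pairwise_commute_slot (A : Type*) (m : ℕ) :
    Pairwise fun i j : Fin m => ∀ x y : NCPoly A,
      Commute (MonoidHomClass.toMonoidHom (slot i : NCPoly A →ₐ[ℚ] TensorPow A m) x)
        (MonoidHomClass.toMonoidHom (slot j : NCPoly A →ₐ[ℚ] TensorPow A m) y) :=
  fun _ _ hij x y => commute_slot hij x y

/-- The map `(x_1, …, x_m) ↦ x_1 ⊗ ⋯ ⊗ x_m`. -/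
def pureTensor (A : Type*) (m : ℕ) : (Fin m → NCPoly A) →* TensorPow A m :=
  MonoidHom.noncommPiCoprod
    (fun i => (MonoidHomClass.toMonoidHom (slot i : NCPoly A →ₐ[ℚ] TensorPow A m)))
    (pairwise_commute_slot A m)

theorem pureTensor_mulSingle {A : Type*} {m : ℕ} (i : Fin m) (x : NCPoly A) :
    pureTensor A m (Pi.mulSingle i x) = slot i x :=
  MonoidHom.noncommPiCoprod_mulSingle _ _ _

theorem pureTensor_apply {A : Type*} {m : ℕ} (x : Fin m → NCPoly A) :
    pureTensor A m x = (List.ofFn fun i => slot i (x i)).prod := by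
  rw [pureTensor, MonoidHom.noncommPiCoprod_apply, List.ofFn_eq_map,
    ← Finset.noncommProd_toFinset _ _ _ (List.nodup_finRange m)]
  · congr 1
    simp
  · exact fun i _ j _ hij => commute_slot hij _ _

theorem prod_ofFn_mulSingle {M : Type*} [Monoid M] {m : ℕ} (u : Fin m → M) :
    (List.ofFn fun i => Pi.mulSingle i (u i) : List (Fin m → M)).prod = u := by
  have h := Finset.noncommProd_mulSingle u
  rw [List.ofFn_eq_map,
    ← Finset.noncommProd_toFinset _ _ _ (List.nodup_finRange m)]
  · convert h
    simp
  · exact fun i _ j _ _ => Pi.mulSingle_apply_commute u i j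

theorem concat_pureTensor {A : Type u} {m : ℕ} (x : Fin m → NCPoly A) :
    concat A m (pureTensor A m x) = (List.ofFn x).prod := by
  have key : (concat A m).compMultilinearMap
      ((MultilinearMap.mkPiAlgebraFin ℚ m (TensorPow A m)).compLinearMap
        fun i => (slot i : NCPoly A →ₐ[ℚ] TensorPow A m).toLinearMap) =
      MultilinearMap.mkPiAlgebraFin ℚ m (NCPoly A) := by
    -- Both sides are multilinear, so it suffices to compare them on tuples of words.
    refine Module.Basis.ext_multilinear (fun _ => MonoidAlgebra.basis (FreeMonoid A) ℚ)
      fun u => ?_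
    -- Stated for a general monoid because it is needed both for words and for tuples of words.
    have hprod : ∀ (M : Type u) [Monoid M] (v : Fin m → M),
        (List.ofFn fun i => (MonoidAlgebra.single (v i) 1 : MonoidAlgebra ℚ M)).prod =
          MonoidAlgebra.single (List.ofFn v).prod 1 := fun M _ v => by
      have := map_list_prod (MonoidAlgebra.of ℚ M) (List.ofFn v)
      rw [MonoidAlgebra.of_apply, List.map_ofFn] at this
      exact this.symm
    simp only [LinearMap.compMultilinearMap_apply, MultilinearMap.compLinearMap_apply,
      MultilinearMap.mkPiAlgebraFin_apply, MonoidAlgebra.basis_apply, AlgHom.toLinearMap_apply,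
      slot_single, hprod, prod_ofFn_mulSingle, concat_single]
  rw [pureTensor_apply]
  exact DFunLike.congr_fun key x

/-! ### Sorting a product of tensors by factors -/

/-- The indices `0, …, k - 1`, sorted by the value of `f`. -/
def fiberList {k m : ℕ} (f : Fin k → Fin m) : List (Fin k) :=
  (List.finRange m).flatMap fun i => (List.finRange k).filter fun j => f j = i

/-- As `pureTensor` is multiplicative, the product can be formed in the monoid of m-tuples. There
coordinate i collects, in order, the factors with f j = i. -/
theorem concat_prod_slot {A : Type*} {k m : ℕ} (f : Fin k → Fin m) (P : Fin k → NCPoly A) :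
    concat A m (List.ofFn fun j => slot (f j) (P j)).prod = ((fiberList f).map P).prod := by
  have h1 : (List.ofFn fun j => (slot (f j) (P j) : TensorPow A m)).prod =
      pureTensor A m (List.ofFn fun j => Pi.mulSingle (f j) (P j)).prod := by
    rw [map_list_prod, List.map_ofFn]
    simp only [Function.comp_def, pureTensor_mulSingle]
  have h2 : ∀ i, (List.ofFn fun j => (Pi.mulSingle (f j) (P j) : Fin m → NCPoly A)).prod i =
      (((List.finRange k).filter fun j => f j = i).map P).prod := fun i => by
    rw [← Pi.evalMonoidHom_apply (f := fun _ => NCPoly A) i (List.prod _), map_list_prod, List.ofFn_eq_map,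
      List.map_map]
    induction List.finRange k with
    | nil => simp
    | cons j l ih =>
      rw [List.map_cons, List.prod_cons, ih, List.filter_cons]
      by_cases hj : f j = i
      · subst hj
        simp
      · simp [hj]
  rw [h1, concat_pureTensor, fiberList, List.map_flatMap, List.flatMap_def, List.prod_flatten,
    List.map_map, List.ofFn_eq_map]
  exact congrArg List.prod (List.map_congr_left fun i _ => h2 i)

/-! ### Multidegrees -/

/-- `x` is homogeneous of multidegree `d`. -/
def IsMultiHomog {A : Type*} {m : ℕ} (d : Fin m → ℕ) (x : TensorPow A m) : Prop :=
  ∀ u, x.coeff u ≠ 0 → (fun i => (u i).length) = d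

theorem degProj_of_isMultiHomog {A : Type*} {m : ℕ} {d e : Fin m → ℕ} {x : TensorPow A m}
    (hx : IsMultiHomog e x) : degProj A d x = if e = d then x else 0 := by
  have h : x = ∑ u ∈ x.coeff.support, MonoidAlgebra.single u (x.coeff u) := by
    ext u
    simp only [MonoidAlgebra.coeff_sum, MonoidAlgebra.coeff_single]
    exact DFunLike.congr_fun (Finsupp.sum_single x.coeff).symm u
  have h2 : degProj A d x = ∑ u ∈ x.coeff.support,
      if e = d then MonoidAlgebra.single u (x.coeff u) else 0 := by
    conv_lhs => rw [h]
    rw [map_sum]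
    refine Finset.sum_congr rfl fun u hu => ?_
    rw [degProj_single, hx u (Finsupp.mem_support_iff.mp hu)]
  rw [h2]
  split_ifs
  · exact h.symm
  · simp

theorem exists_mul_eq_of_coeff_mul_ne_zero {M : Type*} [Monoid M] {x y : MonoidAlgebra ℚ M} {w : M}
    (h : (x * y).coeff w ≠ 0) : ∃ u v, x.coeff u ≠ 0 ∧ y.coeff v ≠ 0 ∧ u * v = w := by
  classical
  have := MonoidAlgebra.support_coeff_mul_subset x y (Finsupp.mem_support_iff.mpr h)
  obtain ⟨u, hu, v, hv, rfl⟩ := Finset.mem_mul.mp this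
  exact ⟨u, v, Finsupp.mem_support_iff.mp hu, Finsupp.mem_support_iff.mp hv, rfl⟩

theorem IsMultiHomog.mul {A : Type*} {m : ℕ} {d e : Fin m → ℕ} {x y : TensorPow A m}
    (hx : IsMultiHomog d x) (hy : IsMultiHomog e y) : IsMultiHomog (d + e) (x * y) := by
  intro w hw
  obtain ⟨u, v, hu, hv, rfl⟩ := exists_mul_eq_of_coeff_mul_ne_zero hw
  rw [← hx u hu, ← hy v hv]
  funext i
  simp

theorem isMultiHomog_one {A : Type*} {m : ℕ} : IsMultiHomog 0 (1 : TensorPow A m) := by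
  classical
  intro w hw
  rw [MonoidAlgebra.one_def, MonoidAlgebra.coeff_single, Finsupp.single_apply] at hw
  rw [← (ite_ne_right_iff.mp hw).1]
  funext i
  simp

theorem IsHomog.slot {A : Type*} {m : ℕ} {d : ℕ} {x : NCPoly A} (hx : IsHomog d x) (i : Fin m) :
    IsMultiHomog (Pi.single i d) (slot i x) := by
  classical
  intro u hu
  obtain ⟨w, hw, rfl⟩ : ∃ w, x.coeff w ≠ 0 ∧ Pi.mulSingle i w = u := by
    have h : (DescentAlgebra.slot i x : TensorPow A m).coeff =
        x.coeff.mapDomain (Pi.mulSingle i) := rfl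
    rw [h] at hu
    obtain ⟨w, hw, hwu⟩ :=
      Finset.mem_image.mp (Finsupp.mapDomain_support (Finsupp.mem_support_iff.mpr hu))
    exact ⟨w, Finsupp.mem_support_iff.mp hw, hwu⟩
  rw [← hx w hw]
  funext j
  by_cases hj : j = i
  · subst hj
    simp
  · simp [hj]

theorem isMultiHomog_prod_slot {A : Type*} {k m : ℕ} {P : Fin k → NCPoly A} {e : Fin k → ℕ}
    (hP : ∀ j, IsHomog (e j) (P j)) (f : Fin k → Fin m) :
    IsMultiHomog (fun i => ∑ j, if f j = i then e j else 0)
      (List.ofFn fun j => (slot (f j) (P j) : TensorPow A m)).prod := by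
  have h : ∀ l : List (Fin k), IsMultiHomog (l.map fun j => Pi.single (f j) (e j)).sum
      (l.map fun j => (slot (f j) (P j) : TensorPow A m)).prod := by
    intro l
    induction l with
    | nil => exact isMultiHomog_one
    | cons j l ih => exact ((hP j).slot (f j)).mul ih
  have h2 := h (List.finRange k)
  rw [← List.ofFn_eq_map, ← List.ofFn_eq_map, List.sum_ofFn] at h2
  convert h2 using 1
  funext i
  rw [Finset.sum_apply]
  exact Finset.sum_congr rfl fun j _ => by simp [Pi.single_apply, eq_comm]

/-- The part of multidegree `d` of the coproduct of a product of primitive homogeneous polynomials,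
multiplied out. -/
theorem concat_degProj_coprod {A : Type*} {k m : ℕ} {P : Fin k → NCPoly A} {e : Fin k → ℕ}
    (hP : ∀ j, IsHomog (e j) (P j)) (hprim : ∀ j, coprod A m (P j) = ∑ i, slot i (P j))
    (d : Fin m → ℕ) :
    concat A m (degProj A d (coprod A m (List.ofFn P).prod)) =
      ∑ f : Fin k → Fin m with ∀ i, (∑ j, if f j = i then e j else 0) = d i,
        ((fiberList f).map P).prod := by
  have h : coprod A m (List.ofFn P).prod =
      ∑ f : Fin k → Fin m, (List.ofFn fun j => slot (f j) (P j)).prod := by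
    rw [map_list_prod, List.map_ofFn]
    simp only [Function.comp_def, hprim]
    -- The ordered product is viewed as a multilinear map, so that a noncommutative product of sums
    -- expands over all choice functions f.
    simp only [← MultilinearMap.mkPiAlgebraFin_apply (R := ℚ)]
    exact MultilinearMap.map_sum _ _
  rw [h, map_sum, map_sum, Finset.sum_filter]
  refine Finset.sum_congr rfl fun f _ => ?_
  rw [degProj_of_isMultiHomog (isMultiHomog_prod_slot hP f), apply_ite (concat A m), map_zero,
    concat_prod_slot]
  exact if_congr funext_iff rfl rfl

end DescentAlgebra

end

noncomputable section

namespace DescentAlgebra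

/-! ### The action of `B_ν` in terms of the coproduct -/

theorem mem_fiberList {k m : ℕ} (f : Fin k → Fin m) (j : Fin k) : j ∈ fiberList f := by
  simp [fiberList]

theorem nodup_fiberList {k m : ℕ} (f : Fin k → Fin m) : (fiberList f).Nodup := by
  refine List.nodup_flatMap.mpr ⟨fun i _ => (List.nodup_finRange k).filter _, ?_⟩
  refine (List.nodup_finRange m).imp fun {i i'} hii' j hj hj' => hii' ?_
  simp only [List.mem_filter, decide_eq_true_eq] at hj hj'
  exact hj.2.symm.trans hj'.2

theorem fiberList_perm {k m : ℕ} (f : Fin k → Fin m) : (fiberList f).Perm (List.finRange k) :=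
  (List.perm_ext_iff_of_nodup (nodup_fiberList f) (List.nodup_finRange k)).mpr fun j =>
    iff_of_true (mem_fiberList f j) (List.mem_finRange j)

/-- Both lists enumerate all indices in increasing lexicographic order of (f j, j); such an
enumeration is unique. -/
theorem fiberList_eq_map_sort {k m : ℕ} (f : Fin k → Fin m) :
    fiberList f = (List.finRange k).map (Tuple.sort f) := by
  obtain ⟨hmono, hlt⟩ := Tuple.eq_sort_iff.mp (rfl : Tuple.sort f = Tuple.sort f)
  refine List.Perm.eq_of_pairwise (le := fun a b => f a < f b ∨ (f a = f b ∧ a < b)) ?_ ?_ ?_ ?_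
  · rintro a b - - (h | ⟨h, h'⟩) (g | ⟨g, g'⟩)
    · exact absurd h g.asymm
    · exact absurd h g.not_gt
    · exact absurd g h.not_gt
    · exact absurd h' g'.asymm
  · refine List.pairwise_flatMap.mpr ⟨fun i _ => ?_, ?_⟩
    · refine List.Pairwise.imp_of_mem ?_ ((List.pairwise_lt_finRange k).filter _)
      intro a b ha hb hab
      simp only [List.mem_filter, decide_eq_true_eq] at ha hb
      exact Or.inr ⟨ha.2.trans hb.2.symm, hab⟩
    · refine (List.pairwise_lt_finRange m).imp fun {i i'} hii' a ha b hb => ?_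
      simp only [List.mem_filter, decide_eq_true_eq] at ha hb
      exact Or.inl (by rw [ha.2, hb.2]; exact hii')
  · refine List.pairwise_map.mpr ((List.pairwise_lt_finRange k).imp fun {a b} hab => ?_)
    rcases (hmono hab.le).lt_or_eq with h | h
    · exact Or.inl h
    · exact Or.inr ⟨h, hlt a b hab h⟩
  · refine (fiberList_perm f).trans ?_
    refine (List.perm_ext_iff_of_nodup (List.nodup_finRange k)
      ((List.nodup_map_iff (Tuple.sort f).injective).mpr (List.nodup_finRange k))).mpr fun j => ?_
    simp only [List.mem_finRange, List.mem_map, true_and, true_iff]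
    exact (Tuple.sort f).surjective j

theorem sum_index_eq {n : ℕ} (ν : Composition n) (i : Fin ν.length) :
    (∑ j, if ν.index j = i then 1 else 0) = ν.blocksFun i := by
  have h : ∀ p : (Σ i : Fin ν.length, Fin (ν.blocksFun i)),
      ν.index (ν.blocksFinEquiv p) = p.1 := fun p => ν.index_embedding p.1 p.2
  rw [← ν.blocksFinEquiv.sum_comp, Fintype.sum_sigma]
  simp only [h]
  simp

/-- Equal fibre sizes make `ν.index` a rearrangement of f, and a tuple has only one monotone
rearrangement. -/
theorem comp_sort_eq_index {n : ℕ} (ν : Composition n) {f : Fin n → Fin ν.length}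
    (hf : ∀ i, (∑ j, if f j = i then 1 else 0) = ν.blocksFun i) : f ∘ Tuple.sort f = ν.index := by
  have hcard : ∀ i, Nonempty ({j // ν.index j = i} ≃ {j // f j = i}) := fun i => by
    refine Fintype.card_eq.mp ?_
    rw [Fintype.card_subtype, Fintype.card_subtype, Finset.card_filter, Finset.card_filter, hf,
      sum_index_eq]
  have e := fun i => (hcard i).some
  have hτ : f ∘ Equiv.ofFiberEquiv e = ν.index := funext fun j => Equiv.ofFiberEquiv_map e j
  rw [Tuple.unique_monotone (Tuple.monotone_sort f) (hτ.symm ▸ index_monotone ν), hτ]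

theorem prod_map_letter {A : Type*} {k : ℕ} (a : Fin k → A) (l : List (Fin k)) :
    (l.map fun p => (MonoidAlgebra.single (FreeMonoid.of (a p)) 1 : NCPoly A)).prod =
      MonoidAlgebra.single (FreeMonoid.ofList (l.map a)) 1 := by
  induction l with
  | nil => rfl
  | cons p l ih =>
    rw [List.map_cons, List.prod_cons, ih, MonoidAlgebra.single_mul_single, mul_one]
    rfl

theorem wordAct_ofFn {A : Type*} {n : ℕ} (a : Fin n → A) (σ : Equiv.Perm (Fin n)) :
    wordAct n (FreeMonoid.ofList (List.ofFn a)) σ =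
      MonoidAlgebra.single (FreeMonoid.ofList ((List.finRange n).map (a ∘ σ))) 1 := by
  rw [wordAct, dif_pos (by simp), ← List.ofFn_eq_map]
  congr 3
  funext i
  simp
  rfl

theorem isHomog_letter {A : Type*} (a : A) :
    IsHomog 1 (MonoidAlgebra.single (FreeMonoid.of a) 1 : NCPoly A) := by
  classical
  intro w hw
  rw [MonoidAlgebra.coeff_single, Finsupp.single_apply] at hw
  rw [← (ite_ne_right_iff.mp hw).1, FreeMonoid.length_of]

-- The bijection sends σ to `ν.index ∘ σ.symm`, with inverse f ↦ `Tuple.sort f`. The word length N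
-- is left free so that all words are covered: for N ≠ n the left side vanishes by the convention in
-- `wordAct`, and on the right no f is admissible, because summing the fibre sizes would give N = n.
open Classical in
theorem sum_wordAct_eq {A : Type*} {n N : ℕ} (ν : Composition n) (a : Fin N → A) :
    ∑ σ : Equiv.Perm (Fin n) with
        σ ∈ minLeftCosetReps (simpleSet n) (simpleSet n \ simpleSubset ν),
      wordAct n (FreeMonoid.ofList (List.ofFn a)) σ =
    ∑ f : Fin N → Fin ν.length with ∀ i, (∑ j, if f j = i then 1 else 0) = ν.blocksFun i,
      ((fiberList f).map fun p => MonoidAlgebra.single (FreeMonoid.of (a p)) (1 : ℚ)).prod := by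
  by_cases hN : N = n
  · subst hN
    refine Finset.sum_bij' (fun σ _ => ν.index ∘ σ.symm) (fun f _ => Tuple.sort f) ?_ ?_ ?_ ?_ ?_
    · intro σ _
      refine Finset.mem_filter.mpr ⟨Finset.mem_univ _, fun i => ?_⟩
      rw [← sum_index_eq, ← Equiv.sum_comp σ]
      simp
    · intro f hf
      have h := comp_sort_eq_index ν (Finset.mem_filter.mp hf).2
      refine Finset.mem_filter.mpr ⟨Finset.mem_univ _, ?_⟩
      rw [mem_minLeftCosetReps_iff, ← h]
      exact (Tuple.eq_sort_iff.mp rfl).2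
    · intro σ hσ
      have h := (mem_minLeftCosetReps_iff ν σ).mp (Finset.mem_filter.mp hσ).2
      refine (Tuple.eq_sort_iff.mpr ⟨?_, ?_⟩).symm
      · simpa [Function.comp_assoc] using index_monotone ν
      · simpa using h
    · intro f hf
      have h := comp_sort_eq_index ν (Finset.mem_filter.mp hf).2
      rw [← h]
      funext j
      simp
    · intro σ hσ
      have h := (mem_minLeftCosetReps_iff ν σ).mp (Finset.mem_filter.mp hσ).2
      have hs : σ = Tuple.sort (ν.index ∘ σ.symm) := by
        refine Tuple.eq_sort_iff.mpr ⟨?_, ?_⟩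
        · simpa [Function.comp_assoc] using index_monotone ν
        · simpa using h
      rw [wordAct_ofFn, prod_map_letter, fiberList_eq_map_sort, ← hs, List.map_map]
  · rw [Finset.sum_eq_zero, Finset.sum_eq_zero]
    · intro f hf
      exfalso
      have h := (Finset.mem_filter.mp hf).2
      apply hN
      have h2 := ν.sum_blocksFun
      simp only [← h] at h2
      rw [Finset.sum_comm] at h2
      simpa using h2
    · intro σ _
      rw [wordAct, dif_neg]
      simpa using hN

theorem polyAct_zero {A : Type*} {n : ℕ} (f : MonoidAlgebra ℚ (Equiv.Perm (Fin n))) :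
    polyAct (0 : NCPoly A) f = 0 := by
  simp [polyAct]

theorem polyAct_add {A : Type*} {n : ℕ} (x y : NCPoly A)
    (f : MonoidAlgebra ℚ (Equiv.Perm (Fin n))) :
    polyAct (x + y) f = polyAct x f + polyAct y f := by
  rw [polyAct, MonoidAlgebra.coeff_add]
  refine Finsupp.sum_add_index' (fun w => by simp) fun w r s => ?_
  simp only [add_mul, add_smul, Finsupp.sum_add]

open Classical in
theorem polyAct_single_descentBasis {A : Type*} {n : ℕ} (ν : Composition n) (w : FreeMonoid A)
    (r : ℚ) :
    polyAct (MonoidAlgebra.single w r) (descentBasis ν) =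
      r • ∑ σ : Equiv.Perm (Fin n) with
          σ ∈ minLeftCosetReps (simpleSet n) (simpleSet n \ simpleSubset ν), wordAct n w σ := by
  rw [polyAct, MonoidAlgebra.coeff_single, Finsupp.sum_single_index (by simp), descentBasis,
    MonoidAlgebra.coeff_sum, ← Finsupp.sum_finsetSum_index, Finset.smul_sum]
  · refine Finset.sum_congr rfl fun σ _ => ?_
    rw [MonoidAlgebra.coeff_single, Finsupp.sum_single_index (by simp), mul_one]
  · simp
  · intro σ b c
    rw [mul_add, add_smul]

/-- `B_ν` acts by taking the part of multidegree `ν` of the coproduct and multiplying out. -/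
theorem polyAct_descentBasis {A : Type*} {n : ℕ} (ν : Composition n) (x : NCPoly A) :
    polyAct x (descentBasis ν) =
      concat A ν.length (degProj A ν.blocksFun (coprod A ν.length x)) := by
  induction x using MonoidAlgebra.induction_linear with
  | zero => simp [polyAct_zero]
  | add x y hx hy => rw [polyAct_add, hx, hy, map_add, map_add, map_add]
  | single w r =>
    have hw : w = FreeMonoid.ofList (List.ofFn w.toList.get) := by
      rw [List.ofFn_get]
      rfl
    have hsingle : (MonoidAlgebra.single w r : NCPoly A) = r • (List.ofFn fun p =>
        (MonoidAlgebra.single (FreeMonoid.of (w.toList.get p)) 1 : NCPoly A)).prod := by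
      rw [List.ofFn_eq_map, prod_map_letter, ← List.ofFn_eq_map, ← hw, MonoidAlgebra.smul_single,
        smul_eq_mul, mul_one]
    -- A word is a product of primitive letters of degree 1, so the general expansion applies with
    -- all degrees equal to 1.
    rw [polyAct_single_descentBasis, hsingle, map_smul, map_smul, map_smul,
      concat_degProj_coprod (fun p => isHomog_letter _) (fun p => coprod_letter _),
      ← sum_wordAct_eq, ← hw]

/-! ### The matrices -/

/-- The matrix with the entries of `κ`, the `j`-th of them in column `j` and row `f j`. -/
def cellMatrix {k m : ℕ} (κ : Fin k → ℕ) (f : Fin k → Fin m) : Matrix (Fin m) (Fin k) ℕ :=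
  fun i j => if f j = i then κ j else 0

/-- Since no κ j vanishes, the nonzero cells are exactly the pairs (f j, j), and reading them by row
is sorting by the value of f. -/
theorem nonzeroCells_cellMatrix {k m : ℕ} {κ : Fin k → ℕ} (hκ : ∀ j, κ j ≠ 0) (f : Fin k → Fin m) :
    nonzeroCells (cellMatrix κ f) = (fiberList f).map fun j => (f j, j) := by
  rw [nonzeroCells, fiberList, List.map_flatMap]
  congr 1
  funext i
  have h : ((List.finRange k).filter fun j => cellMatrix κ f i j ≠ 0) =
      (List.finRange k).filter fun j => f j = i :=
    List.filter_congr fun j _ => by simp [cellMatrix, hκ j]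
  rw [h]
  refine List.map_congr_left fun j hj => ?_
  simp only [List.mem_filter, decide_eq_true_eq] at hj
  rw [hj.2]

theorem rowReading_cellMatrix {k m : ℕ} {κ : Fin k → ℕ} (hκ : ∀ j, κ j ≠ 0) (f : Fin k → Fin m) :
    rowReading (cellMatrix κ f) = (fiberList f).map κ := by
  rw [rowReading, nonzeroCells_cellMatrix hκ, List.map_map]
  exact List.map_congr_left fun j _ => if_pos rfl

theorem rowProduct_cellMatrix {A : Type*} {k m : ℕ} {κ : Fin k → ℕ} (hκ : ∀ j, κ j ≠ 0)
    (f : Fin k → Fin m) (P : Fin k → NCPoly A) :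
    rowProduct P (cellMatrix κ f) = ((fiberList f).map P).prod := by
  rw [rowProduct, nonzeroCells_cellMatrix hκ, List.map_map]
  rfl

theorem cellMatrix_injective {k m : ℕ} {κ : Fin k → ℕ} (hκ : ∀ j, κ j ≠ 0) :
    Function.Injective (cellMatrix (m := m) κ) := by
  intro f g h
  funext j
  have h1 := congrFun (congrFun h (f j)) j
  by_contra hne
  simp [cellMatrix, Ne.symm hne, hκ j] at h1

theorem blocksFun_ne_zero {n : ℕ} (κ : Composition n) (j : Fin κ.length) : κ.blocksFun j ≠ 0 :=
  Nat.one_le_iff_ne_zero.mp (κ.one_le_blocksFun j)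

theorem mem_actionMatrices_iff {n : ℕ} (κ ν : Composition n)
    (z : Matrix (Fin ν.length) (Fin κ.length) ℕ) :
    z ∈ actionMatrices κ ν ↔ ∃ f : Fin κ.length → Fin ν.length,
      (∀ i, (∑ j, if f j = i then κ.blocksFun j else 0) = ν.blocksFun i) ∧
        cellMatrix κ.blocksFun f = z := by
  constructor
  · rintro ⟨hcol, hrow, huniq⟩
    -- f j is the row of the only nonzero entry in column j; the column sum then forces that entry
    -- to be the j-th part of κ.
    choose f hf huniq using huniq
    have hz : cellMatrix κ.blocksFun f = z := by
      funext i j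
      have hzero : ∀ i, i ≠ f j → z i j = 0 := fun i hi => by
        by_contra hne
        exact hi (huniq j i hne)
      rw [cellMatrix]
      split_ifs with h
      · subst h
        rw [← hcol j]
        exact Finset.sum_eq_single _ (fun i _ hi => hzero i hi) (by simp)
      · exact (hzero i (Ne.symm h)).symm
    refine ⟨f, fun i => ?_, hz⟩
    rw [← hrow i, ← hz]
    rfl
  · rintro ⟨f, hf, rfl⟩
    refine ⟨fun j => by simp [cellMatrix], hf, fun j => ⟨f j, ?_, fun i hi => ?_⟩⟩
    · simpa [cellMatrix] using blocksFun_ne_zero κ j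
    · by_contra hne
      exact hi (if_neg (Ne.symm hne))

theorem map_blocksFun_fiberList_perm {n m : ℕ} (κ : Composition n) (f : Fin κ.length → Fin m) :
    ((fiberList f).map κ.blocksFun).Perm κ.blocks := by
  rw [← κ.ofFn_blocksFun, List.ofFn_eq_map]
  exact (fiberList_perm f).map _

theorem isLieMonomial_prod_fiberList {A : Type*} {n m : ℕ} {κ : Composition n}
    {P : Fin κ.length → NCPoly A} (hP : IsLieFamily κ P) (f : Fin κ.length → Fin m) :
    ∃ c : Composition n, c.blocks = (fiberList f).map κ.blocksFun ∧
      IsLieMonomial c ((fiberList f).map P).prod := by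
  let c : Composition n :=
    { blocks := (fiberList f).map κ.blocksFun
      blocks_pos := fun {i} hi =>
        κ.blocks_pos ((map_blocksFun_fiberList_perm κ f).mem_iff.mp hi)
      blocks_sum := (map_blocksFun_fiberList_perm κ f).sum_eq.trans κ.blocks_sum }
  have hlen : c.length = (fiberList f).length := List.length_map _
  refine ⟨c, rfl, fun j => P ((fiberList f).get (j.cast hlen)), fun j => ?_, ?_⟩
  · have h := hP ((fiberList f).get (j.cast hlen))
    refine ⟨h.1, ?_⟩
    convert h.2 using 1
    exact List.getElem_map κ.blocksFun
  · congr 1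
    refine List.ext_getElem (by simp [hlen]) fun i h1 h2 => ?_
    simp

/-- The segments of the cut are the fibres of f, taken in order. -/
theorem adjacentSums_map_fiberList {k m : ℕ} (κ : Fin k → ℕ) (f : Fin k → Fin m) (ν : Fin m → ℕ)
    (hf : ∀ i, (∑ j, if f j = i then κ j else 0) = ν i) :
    AdjacentSums ((fiberList f).map κ) (List.ofFn ν) := by
  refine ⟨(List.finRange m).map fun i => ((List.finRange k).filter fun j => f j = i).map κ, ?_, ?_⟩
  · rw [fiberList, List.map_flatMap, List.flatMap_def]
  · rw [List.map_map, List.ofFn_eq_map]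
    refine List.map_congr_left fun i _ => ?_
    rw [Function.comp_apply, ← hf i, ← List.sum_ofFn, List.ofFn_eq_map]
    induction List.finRange k with
    | nil => rfl
    | cons j l ih =>
      rw [List.filter_cons, List.map_cons, List.sum_cons, ← ih]
      split_ifs <;> simp_all

end DescentAlgebra

end

/-! ### The action formula and the vanishing criterion -/

theorem mainTheorem5 {A : Type*} (n : ℕ) (κ ν : Composition n)
    (P : Fin κ.length → DescentAlgebra.NCPoly A) (hP : DescentAlgebra.IsLieFamily κ P) :
    (DescentAlgebra.polyAct (List.ofFn P).prod (DescentAlgebra.descentBasis ν) =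
      ∑ z ∈ (DescentAlgebra.actionMatrices_finite κ ν).toFinset,
        DescentAlgebra.rowProduct P z) ∧
    (∀ z ∈ DescentAlgebra.actionMatrices κ ν, ∃ c : Composition n,
      c.blocks = DescentAlgebra.rowReading z ∧
        DescentAlgebra.IsLieMonomial c (DescentAlgebra.rowProduct P z)) ∧
    ((¬ ∃ l : List ℕ, l.Perm κ.blocks ∧ DescentAlgebra.AdjacentSums l ν.blocks) →
      DescentAlgebra.polyAct (List.ofFn P).prod (DescentAlgebra.descentBasis ν) = 0) := by
  open DescentAlgebra in
  have hκ := blocksFun_ne_zero κ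
  have hact : polyAct (List.ofFn P).prod (descentBasis ν) =
      ∑ f : Fin κ.length → Fin ν.length with
        ∀ i, (∑ j, if f j = i then κ.blocksFun j else 0) = ν.blocksFun i,
          ((fiberList f).map P).prod := by
    rw [polyAct_descentBasis]
    exact concat_degProj_coprod (fun j => (hP j).2) (fun j => coprod_of_mem_freeLie _ (hP j).1) _
  refine ⟨?_, ?_, ?_⟩
  · rw [hact]
    refine Finset.sum_bij (fun f _ => cellMatrix κ.blocksFun f) ?_ ?_ ?_ ?_
    · intro f hf
      rw [Set.Finite.mem_toFinset, mem_actionMatrices_iff]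
      exact ⟨f, (Finset.mem_filter.mp hf).2, rfl⟩
    · exact fun f _ g _ h => cellMatrix_injective hκ h
    · intro z hz
      rw [Set.Finite.mem_toFinset, mem_actionMatrices_iff] at hz
      obtain ⟨f, hf, rfl⟩ := hz
      exact ⟨f, Finset.mem_filter.mpr ⟨Finset.mem_univ _, hf⟩, rfl⟩
    · exact fun f _ => (rowProduct_cellMatrix hκ f P).symm
  · intro z hz
    obtain ⟨f, -, rfl⟩ := (mem_actionMatrices_iff κ ν z).mp hz
    rw [rowReading_cellMatrix hκ, rowProduct_cellMatrix hκ]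
    exact isLieMonomial_prod_fiberList hP f
  · intro hno
    rw [hact]
    -- A single admissible f would already yield a forbidden reordering of κ, so the sum has no
    -- terms.
    refine Finset.sum_eq_zero fun f hf => absurd ?_ hno
    have h := adjacentSums_map_fiberList κ.blocksFun f ν.blocksFun (Finset.mem_filter.mp hf).2
    rw [ν.ofFn_blocksFun] at h
    exact ⟨_, map_blocksFun_fiberList_perm κ f, h⟩
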